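/- Work over $\mathbb{C}$. Let $n\ge 2$, let $1\le d_0\le d_1\le\cdots\le d_n$ be integers, put $d=d_0+\cdots+d_n$ and $F=x_0^{d_0}\cdots x_n^{d_n}\in\mathbb{C}[x_0,\dots,x_n]_d$, and let $m=\max\{i : d_i=d_0\}$. A point $p=[p_0:\cdots:p_n]\in\mathbb{P}^n$ is identified with the class $[L]$ of the linear form $L=p_0x_0+\cdots+p_nx_n$. The Waring rank $\operatorname{rk}(F)$ is the least $r$ such that $F$ is a sum of $r$ $d$-th powers of linear forms. The Waring locus $\mathcal{W}(F)\subseteq\mathbb{P}^n$ is the set of all $[L]$ for which there are $[L_2],\dots,[L_r]\in\mathbb{P}^n$, with $r=\operatorname{rk}(F)$, such that $F\in\langle L^d,L_2^d,\dots,L_r^d\rangle$; the forbidden locus is $\mathcal{F}(F)=\mathbb{P}^n\setminus\mathcal{W}(F)$. Let $\mathrm{Eig}(F)\subseteq\mathbb{P}^n$ be the set of points of the eigenscheme of $F$, that is, the common zero locus of the $2\times 2$ minors of the matrix with rows $\nabla F(x)$ and $x=(x_0,\dots,x_n)$. Then: 1. if $d_0\ge 2$, then $\mathcal{F}(F)\subsetneq\mathrm{Eig}(F)$;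 2. if $d_0=1$, then $\mathrm{Eig}(F)\cap\mathcal{F}(F)=\bigcup_{i=0}^{m}\bigcup_{j\ne i}V(x_i,x_j)$, where $j$ ranges over $\{0,\dots,n\}\setminus\{i\}$; 3. in all cases, $\mathrm{Eig}(F)\cap\mathcal{W}(F)\ne\emptyset$. -/

import Mathlib

open MvPolynomial
open scoped LinearAlgebra.Projectivization

noncomputable section

/-- The linear form `L = p₀ x₀ + ⋯ + pₙ xₙ` with coefficient vector `p`. Through `p ↦ L` we identify
`ℂⁿ⁺¹` with the space of linear forms, and `ℙ ℂ (Fin (n + 1) → ℂ)` with its projectivization. -/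
def linForm {n : ℕ} (p : Fin (n + 1) → ℂ) : MvPolynomial (Fin (n + 1)) ℂ :=
  ∑ i, C (p i) * X i

/-- The Waring rank of a form `F` of degree `d`: the least `r` such that `F` is a sum of `r`
`d`-th powers of linear forms. (Over `ℂ` every form of degree `d ≥ 1` is such a sum.) -/
def waringRank {n : ℕ} (d : ℕ) (F : MvPolynomial (Fin (n + 1)) ℂ) : ℕ :=
  sInf {r : ℕ | ∃ L : Fin r → Fin (n + 1) → ℂ, F = ∑ i, linForm (L i) ^ d}

/-- The Waring locus of a form `F` of degree `d`: the points `[L]` such that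
`F ∈ ⟨L ^ d, L₂ ^ d, …, L_r ^ d⟩` for some `[L₂], …, [L_r]`, where `r = rk F`. The linear span does
not depend on the representatives of the points. -/
def waringLocus {n : ℕ} (d : ℕ) (F : MvPolynomial (Fin (n + 1)) ℂ) :
    Set (ℙ ℂ (Fin (n + 1) → ℂ)) :=
  {P | ∃ (s : ℕ) (Q : Fin s → ℙ ℂ (Fin (n + 1) → ℂ)), waringRank d F = s + 1 ∧
    F ∈ Submodule.span ℂ
      (insert (linForm P.rep ^ d) (Set.range fun i => linForm (Q i).rep ^ d))}

/-- The forbidden locus of a form `F` of degree `d`: the complement of the Waring locus. -/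
def forbiddenLocus {n : ℕ} (d : ℕ) (F : MvPolynomial (Fin (n + 1)) ℂ) :
    Set (ℙ ℂ (Fin (n + 1) → ℂ)) :=
  (waringLocus d F)ᶜ

/-- The set of points of projective space at which all elements of `I` vanish. For a homogeneous
ideal `I` (the only ones used below) this does not depend on the representatives. -/
def projZeroLocus {n : ℕ} (I : Ideal (MvPolynomial (Fin (n + 1)) ℂ)) :
    Set (ℙ ℂ (Fin (n + 1) → ℂ)) :=
  {P | ∀ g ∈ I, eval P.rep g = 0}

/-- The `2 × (n + 1)` matrix with rows `∇F(x)` and `x`. -/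
def eigenMatrix {n : ℕ} (F : MvPolynomial (Fin (n + 1)) ℂ) :
    Matrix (Fin 2) (Fin (n + 1)) (MvPolynomial (Fin (n + 1)) ℂ) :=
  Matrix.of ![fun i => pderiv i F, fun i => X i]

/-- The defining ideal of the eigenscheme of `F`: the ideal of `2 × 2` minors of the matrix with
rows `∇F(x)` and `x`. -/
def eigenIdeal {n : ℕ} (F : MvPolynomial (Fin (n + 1)) ℂ) :
    Ideal (MvPolynomial (Fin (n + 1)) ℂ) :=
  Ideal.span {g | ∃ i j : Fin (n + 1), i < j ∧
    g = ((eigenMatrix F).submatrix id ![i, j]).det}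

/-- The set of (closed) points of the eigenscheme of `F`. -/
def eigLocus {n : ℕ} (F : MvPolynomial (Fin (n + 1)) ℂ) : Set (ℙ ℂ (Fin (n + 1) → ℂ)) :=
  projZeroLocus (eigenIdeal F)

/-- The coordinate subspace `V(x_i, x_j)`. -/
def coordSubspace {n : ℕ} (i j : Fin (n + 1)) : Set (ℙ ℂ (Fin (n + 1) → ℂ)) :=
  projZeroLocus (Ideal.span {X i, X j})

/-- The monomial `x₀ ^ e₀ ⋯ xₙ ^ eₙ`. -/
def monomialForm {n : ℕ} (e : Fin (n + 1) → ℕ) : MvPolynomial (Fin (n + 1)) ℂ :=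
  ∏ i, X i ^ e i

end

/-!
The theorem follows from the description of the Waring locus of a monomial `F = x ^ e` of degree
`d` with minimal exponent `e 0`: it consists of the points at which no coordinate `x i` with
`e i = e 0` vanishes (`mem_waringLocus_monomialForm_iff`). Comparing coefficients,
`F = ∑ c k • L k ^ d` says that the functional `∑ c k • (evaluation at L k)` on forms of degree `d`
is a nonzero multiple of the functional "coefficient of `x ^ e`" (`monomialForm_eq_sum_iff`).

*Lower bound.* Fix `i` and consider the points `L k` off the hyperplane `x i = 0`. A polynomial
relation on them between the monomials in `x j / x i` with exponents at most `e j` can be multiplied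
by a monomial so as to become a form of degree `d` divisible by `x i` whose coefficient of `x ^ e`
is a coefficient of top degree in the relation. The form vanishes at every `L k`, so this coefficient
is zero. Hence these monomials are independent and there are at least `∏_{j ≠ i} (e j + 1)` such
points (`prod_le_card_coeff_ne_zero`). When `e i = e 0`, this number is the rank, so a
minimal decomposition has no point on `x i = 0`.

*Upper bound.* A product of weighted point sets on the coordinate axes of the chart `x 0 = 1`, the
one on the `j`-th axis having `e j + 1` points and vanishing moments in all orders at most
`e j + e 0` except `e j`, gives a decomposition of `F` with `∏_{j ≠ 0} (e j + 1)` terms. Such sets,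
made of roots of unity, can be chosen through any given value of the coordinate if `e j > e 0` and
through any nonzero value if `e j = e 0` (`exists_weights_moments`, `exists_grid_decomposition`).

The eigenpoints are compared with this locus directly: a point at which all partial derivatives of
`F` vanish is an eigenpoint, and the point with coordinates `√(e i)` is an eigenpoint off all
coordinate hyperplanes.
-/

/-! ### Coefficients of powers of linear forms -/

lemma linForm_smul {n : ℕ} (a : ℂ) (p : Fin (n + 1) → ℂ) :
    linForm (a • p) = C a * linForm p := by
  simp [linForm, Finset.mul_sum, mul_assoc]

lemma monomialForm_eq_monomial {n : ℕ} (e : Fin (n + 1) → ℕ) :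
    monomialForm e = monomial (Finsupp.equivFunOnFinite.symm e) 1 := by
  rw [monomialForm, monomial_eq, Finsupp.prod_fintype _ _ (by simp)]
  simp

lemma coeff_monomialForm {n : ℕ} (e b : Fin (n + 1) → ℕ) :
    coeff (Finsupp.equivFunOnFinite.symm b) (monomialForm e) = if b = e then 1 else 0 := by
  rw [monomialForm_eq_monomial, coeff_monomial]
  simp [eq_comm]

lemma linForm_pow {n : ℕ} (p : Fin (n + 1) → ℂ) (d : ℕ) :
    linForm p ^ d = ∑ k ∈ Finset.piAntidiag Finset.univ d,
      C ((Nat.multinomial Finset.univ k : ℂ) * ∏ i, p i ^ k i) * monomialForm k := by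
  rw [linForm, Finset.sum_pow_eq_sum_piAntidiag]
  refine Finset.sum_congr rfl fun k _ => ?_
  simp [monomialForm, mul_pow, Finset.prod_mul_distrib, mul_assoc]

lemma coeff_linForm_pow {n : ℕ} (p : Fin (n + 1) → ℂ) (d : ℕ) (b : Fin (n + 1) → ℕ) :
    coeff (Finsupp.equivFunOnFinite.symm b) (linForm p ^ d) =
      if ∑ i, b i = d then (Nat.multinomial Finset.univ b : ℂ) * ∏ i, p i ^ b i else 0 := by
  rw [linForm_pow, coeff_sum]
  simp only [coeff_C_mul, coeff_monomialForm, mul_ite, mul_one, mul_zero]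
  rw [Finset.sum_ite_eq]
  simp

/-- A monomial is a given combination of `d`-th powers of linear forms exactly when the weighted
moments of the coefficient vectors of order `d` are those of the monomial. -/
lemma monomialForm_eq_sum_iff {n : ℕ} {ι : Type*} [Fintype ι] (e : Fin (n + 1) → ℕ) (c : ι → ℂ)
    (p : ι → Fin (n + 1) → ℂ) :
    monomialForm e = ∑ k, C (c k) * linForm (p k) ^ (∑ i, e i) ↔
      ∀ b : Fin (n + 1) → ℕ, ∑ i, b i = ∑ i, e i →
        (Nat.multinomial Finset.univ b : ℂ) * ∑ k, c k * ∏ i, p k i ^ b i =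
          if b = e then 1 else 0 := by
  have key (b : Fin (n + 1) → ℕ) : coeff (Finsupp.equivFunOnFinite.symm b)
      (∑ k, C (c k) * linForm (p k) ^ (∑ i, e i)) = if ∑ i, b i = ∑ i, e i then
        (Nat.multinomial Finset.univ b : ℂ) * ∑ k, c k * ∏ i, p k i ^ b i else 0 := by
    rw [coeff_sum]
    simp only [coeff_C_mul, coeff_linForm_pow]
    split_ifs
    · rw [Finset.mul_sum]
      exact Finset.sum_congr rfl fun k _ => by ring
    · simp
  constructor
  · intro h b hb
    have := key b
    rwa [← h, coeff_monomialForm, if_pos hb, eq_comm] at this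
  · intro h
    ext b
    obtain ⟨b, rfl⟩ := Finsupp.equivFunOnFinite.symm.surjective b
    rw [key, coeff_monomialForm]
    split_ifs with h1 h2 h2
    · rw [h b h2, if_pos h1]
    · exact absurd (by rw [h1]) h2
    · rw [h b h2, if_neg h1]
    · rfl

lemma multinomial_cast_ne_zero {n : ℕ} (b : Fin (n + 1) → ℕ) :
    (Nat.multinomial Finset.univ b : ℂ) ≠ 0 :=
  Nat.cast_ne_zero.2 (Nat.multinomial_pos _ _).ne'

/-! ### The lower bound for the rank -/

/-- In any decomposition of `x ^ e` as a combination of powers of linear forms, at least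
`∏_{j ≠ i} (e j + 1)` of the linear forms involve `x i`: the monomials of degree at most `e j` in
each `x j / x i` are linearly independent functions on the set of these linear forms. -/
lemma prod_le_card_coeff_ne_zero {n : ℕ} {ι : Type*} [Fintype ι] (e : Fin (n + 1) → ℕ)
    (c : ι → ℂ) (p : ι → Fin (n + 1) → ℂ)
    (h : monomialForm e = ∑ k, C (c k) * linForm (p k) ^ (∑ i, e i))
    (i : Fin (n + 1)) (hi : 1 ≤ e i) :
    ∏ j, (Function.update e i 0 j + 1) ≤ Nat.card {k // p k i ≠ 0} := by
  classical
  rw [monomialForm_eq_sum_iff] at h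
  set A := Fintype.piFinset fun j => Finset.range (Function.update e i 0 j + 1) with hA
  have hAi {a : Fin (n + 1) → ℕ} (ha : a ∈ A) : a i = 0 := by
    simpa using Fintype.mem_piFinset.1 ha i
  have hAj {a : Fin (n + 1) → ℕ} (ha : a ∈ A) (j : Fin (n + 1)) : a j ≤ e j := by
    have := Fintype.mem_piFinset.1 ha j
    rw [Finset.mem_range, Function.update_apply] at this
    split_ifs at this <;> omega
  have hcard : ∏ j, (Function.update e i 0 j + 1) = Fintype.card A := by
    simp [hA, Fintype.card_piFinset]
  let v : A → {k // p k i ≠ 0} → ℂ := fun a k => ∏ j, (p k j / p k i) ^ a.1 j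
  suffices hv : LinearIndependent ℂ v by
    have := hv.fintype_card_le_finrank
    rw [Module.finrank_fintype_fun_eq_card] at this
    rwa [hcard, Nat.card_eq_fintype_card]
  rw [Fintype.linearIndependent_iff]
  intro g hg
  by_contra! hne
  -- A monomial of maximal degree in a relation is isolated by the moment of order `e`.
  obtain ⟨s, hs, hmax⟩ := Finset.exists_max_image
    (Finset.univ.filter fun a : A => g a ≠ 0) (fun a => ∑ j, a.1 j)
    ⟨hne.choose, by simpa using hne.choose_spec⟩
  have hgs : g s ≠ 0 := by simpa using hs
  -- After multiplication by the weight `w` below, the monomial of `a` becomes `x ^ b a`.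
  let b : A → Fin (n + 1) → ℕ := fun a =>
    Function.update (fun j => e j - s.1 j + a.1 j) i (e i + ∑ j, s.1 j - ∑ j, a.1 j)
  have hbi (a : A) : b a i = e i + ∑ j, s.1 j - ∑ j, a.1 j := by simp [b]
  have hbj (a : A) {j : Fin (n + 1)} (hj : j ≠ i) : b a j = e j - s.1 j + a.1 j := by
    simp [b, hj]
  have herase (a : A) : ∑ j ∈ Finset.univ.erase i, a.1 j = ∑ j, a.1 j := by
    rw [← Finset.add_sum_erase _ _ (Finset.mem_univ i), hAi a.2, zero_add]
  have hbsum (a : A) (ha : ∑ j, a.1 j ≤ ∑ j, s.1 j) : ∑ j, b a j = ∑ j, e j := by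
    rw [← Finset.add_sum_erase _ _ (Finset.mem_univ i), hbi,
      ← Finset.add_sum_erase _ e (Finset.mem_univ i)]
    have h1 : ∑ j ∈ Finset.univ.erase i, b a j + ∑ j ∈ Finset.univ.erase i, s.1 j =
        ∑ j ∈ Finset.univ.erase i, e j + ∑ j ∈ Finset.univ.erase i, a.1 j := by
      rw [← Finset.sum_add_distrib, ← Finset.sum_add_distrib]
      refine Finset.sum_congr rfl fun j hj => ?_
      rw [hbj a (Finset.ne_of_mem_erase hj)]
      have := hAj s.2 j
      omega
    rw [herase, herase] at h1
    omega
  have hbe (a : A) (ha : ∑ j, a.1 j ≤ ∑ j, s.1 j) : b a = e ↔ a = s := by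
    constructor
    · intro hab
      ext j
      by_cases hj : j = i
      · rw [hj, hAi a.2, hAi s.2]
      · have := hbj a hj
        have := hAj s.2 j
        have := congrFun hab j
        omega
    · rintro rfl
      funext j
      by_cases hj : j = i
      · rw [hj, hbi]; omega
      · rw [hbj _ hj]
        have := hAj a.2 j
        omega
  let w : ι → ℂ := fun k =>
    c k * (p k i ^ (e i + ∑ j, s.1 j) * ∏ j ∈ Finset.univ.erase i, p k j ^ (e j - s.1 j))
  have hmoment (a : A) (ha : ∑ j, a.1 j ≤ ∑ j, s.1 j) :
      ∑ k : {k // p k i ≠ 0}, w k * v a k = ∑ k, c k * ∏ j, p k j ^ b a j := by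
    have hterm (k : {k // p k i ≠ 0}) : w k * v a k = c k * ∏ j, p k.1 j ^ b a j := by
      have h1 : v a k = (∏ j ∈ Finset.univ.erase i, p k.1 j ^ a.1 j) / p k.1 i ^ ∑ j, a.1 j := by
        simp only [v, div_pow, Finset.prod_div_distrib, Finset.prod_pow_eq_pow_sum]
        rw [← Finset.mul_prod_erase _ _ (Finset.mem_univ i), hAi a.2, pow_zero, one_mul]
      have h2 : ∏ j, p k.1 j ^ b a j = p k.1 i ^ (e i + ∑ j, s.1 j - ∑ j, a.1 j) *
          ((∏ j ∈ Finset.univ.erase i, p k.1 j ^ (e j - s.1 j)) *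
            ∏ j ∈ Finset.univ.erase i, p k.1 j ^ a.1 j) := by
        rw [← Finset.mul_prod_erase _ _ (Finset.mem_univ i), hbi, ← Finset.prod_mul_distrib]
        congr 1
        refine Finset.prod_congr rfl fun j hj => ?_
        rw [hbj a (Finset.ne_of_mem_erase hj), pow_add]
      rw [h1, h2, pow_sub₀ _ k.2 (by omega)]
      simp only [w]
      ring
    simp only [hterm]
    -- The exponent of `x i` is at least `e i ≥ 1`, so the other points do not contribute.
    rw [← Finset.sum_subtype (Finset.univ.filter fun k => p k i ≠ 0) (by simp)
      (fun k => c k * ∏ j, p k j ^ b a j)]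
    refine Finset.sum_subset (Finset.filter_subset _ _) fun k _ hk => ?_
    rw [Finset.prod_eq_zero (Finset.mem_univ i), mul_zero]
    rw [show p k i = 0 by simpa using hk, hbi, zero_pow (by omega)]
  have hzero : ∑ a, g a * ∑ k : {k // p k i ≠ 0}, w k * v a k = 0 := by
    have : ∑ k : {k // p k i ≠ 0}, w k * (∑ a, g a • v a) k = 0 := by
      rw [hg]; simp
    simp only [Finset.sum_apply, Pi.smul_apply, smul_eq_mul, Finset.mul_sum] at this ⊢
    rw [Finset.sum_comm]
    refine Eq.trans ?_ this
    exact Finset.sum_congr rfl fun _ _ => Finset.sum_congr rfl fun _ _ => by ring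
  rw [Finset.sum_eq_single s] at hzero
  · rw [hmoment s le_rfl] at hzero
    have := h (b s) (hbsum s le_rfl)
    rw [if_pos ((hbe s le_rfl).2 rfl), (mul_eq_zero.1 hzero).resolve_left hgs] at this
    simp at this
  · intro a _ has
    by_cases hga : g a = 0
    · simp [hga]
    have ha := hmax a (by simpa using hga)
    have := h (b a) (hbsum a ha)
    rw [if_neg (mt (hbe a ha).1 has)] at this
    rw [hmoment a ha, (mul_eq_zero.1 this).resolve_left (multinomial_cast_ne_zero _), mul_zero]
  · simp

/-! ### Decompositions supported on grids -/

lemma sum_pow_pow_of_isPrimitiveRoot {N : ℕ} {ζ : ℂ} (hζ : IsPrimitiveRoot ζ N) (k : ℕ) :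
    ∑ j : Fin N, (ζ ^ (j : ℕ)) ^ k = if N ∣ k then (N : ℂ) else 0 := by
  rw [Fin.sum_univ_eq_sum_range (fun j => (ζ ^ j) ^ k)]
  simp only [← pow_mul, mul_comm _ k]
  simp only [pow_mul]
  split_ifs with h
  · simp [(hζ.pow_eq_one_iff_dvd k).2 h]
  · have h1 : ζ ^ k ≠ 1 := mt (hζ.pow_eq_one_iff_dvd k).1 h
    rw [geom_sum_eq h1, ← pow_mul, mul_comm, pow_mul, hζ.pow_eq_one]
    simp

/-- A weighted set of `a + 1` points of the complex line, one of them the given `z`, whose moments of order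
at most `a + a₀` vanish except in order `a`. The points are the vertices of a regular polygon
centred at the origin, together with the origin itself if `z = 0`. -/
lemma exists_weights_moments (a a₀ : ℕ) (ha₀ : 1 ≤ a₀) (hle : a₀ ≤ a) (z : ℂ)
    (hz : z ≠ 0 ∨ a₀ < a) :
    ∃ w r : Fin (a + 1) → ℂ, r 0 = z ∧ ∑ j, w j * r j ^ a ≠ 0 ∧
      ∀ k ≤ a + a₀, k ≠ a → ∑ j, w j * r j ^ k = 0 := by
  by_cases h : z = 0
  · subst h
    have ha : a₀ < a := by simpa using hz
    have hζ := Complex.isPrimitiveRoot_exp a (by omega)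
    set ζ := Complex.exp (2 * Real.pi * Complex.I / a)
    have hs (k : ℕ) : ∑ j : Fin (a + 1), (Fin.cons (-(a : ℂ)) (fun _ => 1) : Fin (a + 1) → ℂ) j *
        (Fin.cons 0 (fun j : Fin a => ζ ^ (j : ℕ)) : Fin (a + 1) → ℂ) j ^ k =
        -(a : ℂ) * 0 ^ k + if a ∣ k then (a : ℂ) else 0 := by
      rw [Fin.sum_univ_succ]
      simp [sum_pow_pow_of_isPrimitiveRoot hζ]
    refine ⟨Fin.cons (-(a : ℂ)) fun _ => 1, Fin.cons 0 fun j : Fin a => ζ ^ (j : ℕ), rfl, ?_, ?_⟩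
    · rw [hs, zero_pow (by omega)]
      simpa using (by omega : a ≠ 0)
    · intro k hk hka
      rw [hs]
      rcases Nat.eq_zero_or_pos k with rfl | hk0
      · simp
      · rw [if_neg, zero_pow hk0.ne']
        · simp
        · rintro ⟨t, rfl⟩
          have : t ≠ 1 := by rintro rfl; simp at hka
          have : t ≠ 0 := by rintro rfl; simp at hk0
          nlinarith [(by omega : 2 ≤ t)]
  · have hζ := Complex.isPrimitiveRoot_exp (a + 1) (by omega)
    set ζ := Complex.exp (2 * Real.pi * Complex.I / (a + 1 : ℕ))
    have hs (k : ℕ) : ∑ j : Fin (a + 1), ζ ^ (j : ℕ) * (z * ζ ^ (j : ℕ)) ^ k =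
        z ^ k * if a + 1 ∣ k + 1 then ((a + 1 : ℕ) : ℂ) else 0 := by
      rw [← sum_pow_pow_of_isPrimitiveRoot hζ, Finset.mul_sum]
      exact Finset.sum_congr rfl fun j _ => by ring
    refine ⟨fun j => ζ ^ (j : ℕ), fun j => z * ζ ^ (j : ℕ), by simp, ?_, ?_⟩
    · rw [hs, if_pos dvd_rfl]
      exact mul_ne_zero (pow_ne_zero _ h) (Nat.cast_ne_zero.2 (by omega))
    · intro k hk hka
      rw [hs, if_neg, mul_zero]
      rintro ⟨t, ht⟩
      have : t ≠ 1 := by rintro rfl; omega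
      have : t ≠ 0 := by rintro rfl; omega
      nlinarith [(by omega : 2 ≤ t)]

/-- A monomial is a combination of the powers of the linear forms with coefficient vectors on a
grid with `∏_{j ≠ 0} (e j + 1)` points, all on the affine chart `x 0 = 1`, through a given point
of that chart. The point may have vanishing `j`-th coordinate only if `e 0 < e j`. The factor
indexed by `0` of the grid, `Fin (0 + 1)`, is a single point. -/
lemma exists_grid_decomposition {n : ℕ} (e : Fin (n + 1) → ℕ) (he : 1 ≤ e 0)
    (hmin : ∀ j, e 0 ≤ e j) (z : Fin (n + 1) → ℂ) (hz0 : z 0 = 1)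
    (hz : ∀ j, z j ≠ 0 ∨ e 0 < e j) :
    ∃ (c : (∀ j, Fin (Function.update e 0 0 j + 1)) → ℂ)
      (p : (∀ j, Fin (Function.update e 0 0 j + 1)) → Fin (n + 1) → ℂ),
      p 0 = z ∧ (∀ k, p k 0 = 1) ∧
      monomialForm e = ∑ k, C (c k) * linForm (p k) ^ (∑ i, e i) := by
  have hloc (j : Fin (n + 1)) : ∃ w r : Fin (Function.update e 0 0 j + 1) → ℂ, r 0 = z j ∧
      (j = 0 → ∀ t, r t = 1) ∧ ∑ t, w t * r t ^ e j ≠ 0 ∧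
      (j ≠ 0 → ∀ k ≤ e j + e 0, k ≠ e j → ∑ t, w t * r t ^ k = 0) := by
    rcases eq_or_ne j 0 with rfl | hj
    · refine ⟨fun _ => 1, fun _ => 1, hz0.symm, fun _ _ => rfl, ?_, fun h => absurd rfl h⟩
      simp
    · rw [Function.update_of_ne hj]
      obtain ⟨w, r, h1, h2, h3⟩ := exists_weights_moments (e j) (e 0) he (hmin j) (z j) (hz j)
      exact ⟨w, r, h1, fun h => absurd h hj, h2, fun _ => h3⟩
  choose w r hr0 hr1 hne hvan using hloc
  let s : (Fin (n + 1) → ℕ) → ℂ := fun b => ∏ j, ∑ t, w j t * r j t ^ b j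
  have hs (b : Fin (n + 1) → ℕ) :
      ∑ k : ∀ j, Fin (Function.update e 0 0 j + 1), (∏ j, w j (k j)) * ∏ j, r j (k j) ^ b j =
        s b := by
    simp only [s, Finset.prod_univ_sum, Fintype.piFinset_univ, Finset.prod_mul_distrib]
  have hse : (Nat.multinomial Finset.univ e : ℂ) * s e ≠ 0 :=
    mul_ne_zero (multinomial_cast_ne_zero e) (Finset.prod_ne_zero_iff.2 fun j _ => hne j)
  have hsb (b : Fin (n + 1) → ℕ) (hb : ∑ j, b j = ∑ j, e j) (hbe : b ≠ e) : s b = 0 := by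
    by_contra hsb
    have hsj (j : Fin (n + 1)) : ∑ t, w j t * r j t ^ b j ≠ 0 :=
      Finset.prod_ne_zero_iff.1 hsb j (Finset.mem_univ j)
    have hge (j : Fin (n + 1)) (hj : j ≠ 0) : e j ≤ b j := by
      by_contra! hlt
      exact hsj j (hvan j hj _ (by omega) hlt.ne)
    rw [Fin.sum_univ_succ, Fin.sum_univ_succ e] at hb
    -- The excess `b j - e j` is compensated by the exponent of `x 0`, so it is at most `e 0`.
    have hle (j : Fin n) : b j.succ ≤ e j.succ + e 0 := by
      have h1 := Finset.add_sum_erase Finset.univ (fun j : Fin n => b j.succ) (Finset.mem_univ j)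
      have h2 := Finset.add_sum_erase Finset.univ (fun j : Fin n => e j.succ) (Finset.mem_univ j)
      have h3 : ∑ j ∈ Finset.univ.erase j, e (Fin.succ j) ≤
          ∑ j ∈ Finset.univ.erase j, b (Fin.succ j) :=
        Finset.sum_le_sum fun j _ => hge _ (Fin.succ_ne_zero j)
      omega
    have heq (j : Fin n) : b j.succ = e j.succ := by
      by_contra hbj
      exact hsj _ (hvan _ (Fin.succ_ne_zero j) _ (hle j) hbj)
    refine hbe (funext fun j => ?_)
    cases j using Fin.cases with
    | zero => simpa [heq] using hb
    | succ j => exact heq j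
  refine ⟨fun k => ((Nat.multinomial Finset.univ e : ℂ) * s e)⁻¹ * ∏ j, w j (k j),
    fun k j => r j (k j), funext hr0, fun k => hr1 0 rfl _, ?_⟩
  rw [monomialForm_eq_sum_iff]
  intro b hb
  simp only [mul_assoc, ← Finset.mul_sum]
  rw [hs]
  split_ifs with h
  · subst h
    rw [mul_left_comm, inv_mul_cancel₀ hse]
  · rw [hsb b hb h]
    simp

/-! ### The rank and the forbidden locus of a monomial -/

lemma waringRank_monomialForm {n : ℕ} (e : Fin (n + 1) → ℕ) (he : 1 ≤ e 0)
    (hmin : ∀ j, e 0 ≤ e j) :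
    waringRank (∑ i, e i) (monomialForm e) = ∏ j, (Function.update e 0 0 j + 1) := by
  have hmem : ∏ j, (Function.update e 0 0 j + 1) ∈ {r : ℕ | ∃ L : Fin r → Fin (n + 1) → ℂ,
      monomialForm e = ∑ i, linForm (L i) ^ (∑ i, e i)} := by
    obtain ⟨c, p, -, -, h⟩ := exists_grid_decomposition e he hmin (fun _ => 1) rfl (by simp)
    have hd : 0 < ∑ i, e i :=
      he.trans (Finset.single_le_sum (f := e) (fun _ _ => Nat.zero_le _) (Finset.mem_univ 0))
    -- The coefficients are absorbed into the linear forms by extracting `d`-th roots.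
    choose t ht using fun k => IsAlgClosed.exists_pow_nat_eq (c k) hd
    let ε := Fintype.equivFinOfCardEq (α := ∀ j, Fin (Function.update e 0 0 j + 1))
      (n := ∏ j, (Function.update e 0 0 j + 1)) (by simp)
    refine ⟨fun k => t (ε.symm k) • p (ε.symm k), ?_⟩
    rw [h, ← ε.symm.sum_comp]
    refine Finset.sum_congr rfl fun k _ => ?_
    rw [linForm_smul, mul_pow, ← C_pow, ht]
  refine le_antisymm (Nat.sInf_le hmem) (le_csInf ⟨_, hmem⟩ ?_)
  rintro r ⟨L, hL⟩
  refine (prod_le_card_coeff_ne_zero e (fun _ => 1) L (by simpa using hL) 0 he).trans ?_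
  simpa only [Nat.card_fin] using Nat.card_le_card_of_injective
    (Subtype.val : {k // L k 0 ≠ 0} → Fin r) Subtype.val_injective

lemma prod_update_zero_eq {n : ℕ} (e : Fin (n + 1) → ℕ) {i : Fin (n + 1)} (hi : e i = e 0) :
    ∏ j, (Function.update e i 0 j + 1) = ∏ j, (Function.update e 0 0 j + 1) := by
  have key (i : Fin (n + 1)) :
      (e i + 1) * ∏ j, (Function.update e i 0 j + 1) = ∏ j, (e j + 1) := by
    rw [← Finset.mul_prod_erase _ _ (Finset.mem_univ i),
      ← Finset.mul_prod_erase _ (fun j => e j + 1) (Finset.mem_univ i)]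
    simp only [Function.update_self, zero_add, one_mul]
    congr 1
    refine Finset.prod_congr rfl fun j hj => ?_
    rw [Function.update_of_ne (Finset.ne_of_mem_erase hj)]
  have h1 := key i
  rw [hi, ← key 0] at h1
  exact Nat.eq_of_mul_eq_mul_left (Nat.succ_pos _) h1

/-- The Waring locus of a monomial consists of the points at which no coordinate of minimal
exponent vanishes. -/
lemma mem_waringLocus_monomialForm_iff {n : ℕ} (e : Fin (n + 1) → ℕ) (he : 1 ≤ e 0)
    (hmin : ∀ j, e 0 ≤ e j) (P : ℙ ℂ (Fin (n + 1) → ℂ)) :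
    P ∈ waringLocus (∑ i, e i) (monomialForm e) ↔ ∀ i, e i = e 0 → P.rep i ≠ 0 := by
  constructor
  · rintro ⟨s, Q, hs, hspan⟩ i hi hPi
    have hcons : insert (linForm P.rep ^ (∑ i, e i))
        (Set.range fun i => linForm (Q i).rep ^ (∑ i, e i)) =
        Set.range fun k => linForm ((Fin.cons P Q : Fin (s + 1) → _) k).rep ^ (∑ i, e i) := by
      ext g
      simp [Fin.exists_fin_succ, eq_comm]
    rw [hcons, Submodule.mem_span_range_iff_exists_fun] at hspan
    obtain ⟨c, hc⟩ := hspan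
    have hcard := prod_le_card_coeff_ne_zero e c
      (fun k => ((Fin.cons P Q : Fin (s + 1) → _) k).rep)
      (by rw [← hc]; simp [smul_eq_C_mul]) i (by omega)
    rw [prod_update_zero_eq e hi, ← waringRank_monomialForm e he hmin, hs,
      Nat.card_eq_fintype_card] at hcard
    have := Fintype.card_subtype_lt
      (p := fun k => ((Fin.cons P Q : Fin (s + 1) → ℙ ℂ (Fin (n + 1) → ℂ)) k).rep i ≠ 0)
      (x := 0) (by simpa using hPi)
    rw [Fintype.card_fin] at this
    omega
  · intro hP
    have hP0 := hP 0 rfl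
    obtain ⟨c, p, hp0, hp1, h⟩ := exists_grid_decomposition e he hmin ((P.rep 0)⁻¹ • P.rep)
      (by simp [hP0]) fun j => by
        rcases (hmin j).eq_or_lt with hj | hj
        · exact Or.inl (by simpa [hP0] using hP j hj.symm)
        · exact Or.inr hj
    have hpne (k) : p k ≠ 0 := fun h0 => by simpa [h0] using hp1 k
    classical
    let ι := ∀ j, Fin (Function.update e 0 0 j + 1)
    let ε : {k : ι // k ≠ 0} ≃ Fin (Fintype.card {k : ι // k ≠ 0}) := Fintype.equivFin _
    refine ⟨_, fun t => Projectivization.mk ℂ _ (hpne (ε.symm t).1), ?_, ?_⟩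
    · have : Fintype.card ι = ∏ j, (Function.update e 0 0 j + 1) := by simp [ι]
      have hpos : 0 < Fintype.card ι := Fintype.card_pos
      rw [waringRank_monomialForm e he hmin, ← this, Fintype.card_subtype_compl,
        Fintype.card_subtype_eq]
      omega
    · nth_rw 1 [h]
      refine Submodule.sum_mem _ fun k _ => ?_
      rw [← smul_eq_C_mul]
      refine Submodule.smul_mem _ _ ?_
      by_cases hk : k = 0
      · rw [hk, hp0, linForm_smul, mul_pow, ← C_pow, ← smul_eq_C_mul]
        exact Submodule.smul_mem _ _ (Submodule.subset_span (Set.mem_insert _ _))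
      · obtain ⟨u, hu⟩ := Projectivization.exists_smul_eq_mk_rep ℂ (p k) (hpne k)
        have hpk : p k = ((u⁻¹ : ℂˣ) : ℂ) • (Projectivization.mk ℂ (p k) (hpne k)).rep := by
          rw [← hu, ← Units.smul_def, inv_smul_smul]
        rw [hpk, linForm_smul, mul_pow, ← C_pow, ← smul_eq_C_mul]
        refine Submodule.smul_mem _ _ (Submodule.subset_span (Set.mem_insert_of_mem _ ?_))
        exact ⟨ε ⟨k, hk⟩, by simp⟩

lemma mem_forbiddenLocus_monomialForm_iff {n : ℕ} (e : Fin (n + 1) → ℕ) (he : 1 ≤ e 0)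
    (hmin : ∀ j, e 0 ≤ e j) (P : ℙ ℂ (Fin (n + 1) → ℂ)) :
    P ∈ forbiddenLocus (∑ i, e i) (monomialForm e) ↔ ∃ i, e i = e 0 ∧ P.rep i = 0 := by
  rw [forbiddenLocus, Set.mem_compl_iff, mem_waringLocus_monomialForm_iff e he hmin]
  push Not
  rfl

/-! ### The eigenpoints of a monomial -/

lemma mem_projZeroLocus_span_iff {n : ℕ} (s : Set (MvPolynomial (Fin (n + 1)) ℂ))
    (P : ℙ ℂ (Fin (n + 1) → ℂ)) :
    P ∈ projZeroLocus (Ideal.span s) ↔ ∀ g ∈ s, eval P.rep g = 0 :=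
  Ideal.span_le (I := RingHom.ker (eval P.rep))

lemma mem_eigLocus_iff {n : ℕ} (F : MvPolynomial (Fin (n + 1)) ℂ) (P : ℙ ℂ (Fin (n + 1) → ℂ)) :
    P ∈ eigLocus F ↔
      ∀ i j, P.rep j * eval P.rep (pderiv i F) = P.rep i * eval P.rep (pderiv j F) := by
  rw [eigLocus, eigenIdeal, mem_projZeroLocus_span_iff]
  have hdet (i j : Fin (n + 1)) : eval P.rep ((eigenMatrix F).submatrix id ![i, j]).det =
      P.rep j * eval P.rep (pderiv i F) - P.rep i * eval P.rep (pderiv j F) := by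
    simp [Matrix.det_fin_two, eigenMatrix]
    ring
  constructor
  · intro h i j
    rcases lt_trichotomy i j with hij | rfl | hij
    · exact sub_eq_zero.1 ((hdet i j).symm.trans (h _ ⟨i, j, hij, rfl⟩))
    · rfl
    · exact (sub_eq_zero.1 ((hdet j i).symm.trans (h _ ⟨j, i, hij, rfl⟩))).symm
  · rintro h _ ⟨i, j, -, rfl⟩
    rw [hdet, h, sub_self]

lemma eval_pderiv_monomialForm {n : ℕ} (e : Fin (n + 1) → ℕ) (i : Fin (n + 1))
    (x : Fin (n + 1) → ℂ) :
    eval x (pderiv i (monomialForm e)) =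
      e i * (x i ^ (e i - 1) * ∏ j ∈ Finset.univ.erase i, x j ^ e j) := by
  rw [monomialForm_eq_monomial, pderiv_monomial, eval_monomial, Finsupp.prod_fintype _ _ (by simp),
    ← Finset.mul_prod_erase _ _ (Finset.mem_univ i)]
  simp only [one_mul, Finsupp.coe_tsub, Pi.sub_apply, Finsupp.equivFunOnFinite_symm_apply_apply,
    Finsupp.single_eq_same]
  congr 2
  refine Finset.prod_congr rfl fun j hj => ?_
  rw [Finsupp.single_eq_of_ne (Finset.ne_of_mem_erase hj), tsub_zero]

lemma mul_eval_pderiv_monomialForm {n : ℕ} (e : Fin (n + 1) → ℕ) (i : Fin (n + 1)) (hi : 1 ≤ e i)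
    (x : Fin (n + 1) → ℂ) :
    x i * eval x (pderiv i (monomialForm e)) = e i * ∏ j, x j ^ e j := by
  rw [eval_pderiv_monomialForm, ← Finset.mul_prod_erase _ _ (Finset.mem_univ i),
    ← pow_sub_one_mul (by omega : e i ≠ 0) (x i)]
  ring

/-- A point at which the gradient of `F` vanishes is an eigenpoint. -/
lemma mem_eigLocus_of_pderiv_eq_zero {n : ℕ} {F : MvPolynomial (Fin (n + 1)) ℂ}
    {P : ℙ ℂ (Fin (n + 1) → ℂ)} (h : ∀ i, eval P.rep (pderiv i F) = 0) : P ∈ eigLocus F :=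
  (mem_eigLocus_iff F P).2 fun i j => by rw [h, h, mul_zero, mul_zero]

/-- A monomial has an eigenpoint with no vanishing coordinate, namely the point with coordinates
`√(e i)`: for such points, the eigenpoint equations read `e i * x j ^ 2 = e j * x i ^ 2`. -/
lemma exists_mem_eigLocus_monomialForm {n : ℕ} (e : Fin (n + 1) → ℕ) (he : ∀ i, 1 ≤ e i) :
    ∃ P ∈ eigLocus (monomialForm e), ∀ i, P.rep i ≠ 0 := by
  choose t ht using fun i => IsAlgClosed.exists_pow_nat_eq (e i : ℂ) two_pos
  have hei (i : Fin (n + 1)) : (e i : ℂ) ≠ 0 := Nat.cast_ne_zero.2 (by have := he i; omega)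
  have ht0 (i : Fin (n + 1)) : t i ≠ 0 := fun h => hei i (by rw [← ht, h]; simp)
  have htne : t ≠ 0 := fun h => ht0 0 (by rw [h]; rfl)
  obtain ⟨u, hu⟩ := Projectivization.exists_smul_eq_mk_rep ℂ t htne
  have hrep (i : Fin (n + 1)) : (Projectivization.mk ℂ t htne).rep i = u * t i := by
    rw [← hu]; rfl
  have hne (i : Fin (n + 1)) : (Projectivization.mk ℂ t htne).rep i ≠ 0 := by
    rw [hrep]; exact mul_ne_zero u.ne_zero (ht0 i)
  refine ⟨_, (mem_eigLocus_iff _ _).2 fun i j => ?_, hne⟩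
  have hi := mul_eval_pderiv_monomialForm e i (he i) (Projectivization.mk ℂ t htne).rep
  have hj := mul_eval_pderiv_monomialForm e j (he j) (Projectivization.mk ℂ t htne).rep
  refine mul_left_cancel₀ (mul_ne_zero (hne i) (hne j)) ?_
  have hsq : (Projectivization.mk ℂ t htne).rep j ^ 2 * e i =
      (Projectivization.mk ℂ t htne).rep i ^ 2 * e j := by
    rw [hrep, hrep, mul_pow, mul_pow, ht, ht]; ring
  linear_combination (Projectivization.mk ℂ t htne).rep j ^ 2 * hi -
    (Projectivization.mk ℂ t htne).rep i ^ 2 * hj +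
    (∏ j, (Projectivization.mk ℂ t htne).rep j ^ e j) * hsq

/-! ### Comparison of the two loci -/

theorem mainTheorem5 (n : ℕ) (hn : 2 ≤ n) (e : Fin (n + 1) → ℕ) (he : 1 ≤ e 0)
    (hmono : Monotone e) (m : Fin (n + 1)) (hm : IsGreatest {i | e i = e 0} m) :
    (2 ≤ e 0 →
      forbiddenLocus (∑ i, e i) (monomialForm e) ⊂ eigLocus (monomialForm e)) ∧
    (e 0 = 1 →
      eigLocus (monomialForm e) ∩ forbiddenLocus (∑ i, e i) (monomialForm e) =
        ⋃ (i : Fin (n + 1)) (_ : i ≤ m) (j : Fin (n + 1)) (_ : j ≠ i), coordSubspace i j) ∧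
    (eigLocus (monomialForm e) ∩ waringLocus (∑ i, e i) (monomialForm e)).Nonempty := by
  have hmin (j : Fin (n + 1)) : e 0 ≤ e j := hmono (Fin.zero_le j)
  have hle (i : Fin (n + 1)) : i ≤ m ↔ e i = e 0 :=
    ⟨fun h => le_antisymm ((hmono h).trans hm.1.le) (hmin i), fun h => hm.2 h⟩
  obtain ⟨P, hPeig, hPne⟩ := exists_mem_eigLocus_monomialForm e fun i => he.trans (hmin i)
  have hPW : P ∈ waringLocus (∑ i, e i) (monomialForm e) :=
    (mem_waringLocus_monomialForm_iff e he hmin P).2 fun i _ => hPne i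
  refine ⟨fun h2 => ⟨fun R hR => ?_, fun hsub => hsub hPeig hPW⟩, fun h1 => ?_, P, hPeig, hPW⟩
  · obtain ⟨i, hi, hRi⟩ := (mem_forbiddenLocus_monomialForm_iff e he hmin R).1 hR
    refine mem_eigLocus_of_pderiv_eq_zero fun k => ?_
    rw [eval_pderiv_monomialForm]
    rcases eq_or_ne i k with rfl | hik
    · rw [hRi, zero_pow (by omega), zero_mul, mul_zero]
    · rw [Finset.prod_eq_zero (Finset.mem_erase.2 ⟨hik, Finset.mem_univ i⟩), mul_zero, mul_zero]
      rw [hRi, zero_pow (by omega)]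
  · ext R
    simp only [Set.mem_inter_iff, mem_forbiddenLocus_monomialForm_iff e he hmin, Set.mem_iUnion,
      coordSubspace, mem_projZeroLocus_span_iff, Set.mem_insert_iff, Set.mem_singleton_iff,
      forall_eq_or_imp, forall_eq, eval_X, exists_prop, hle]
    constructor
    · rintro ⟨hR, i, hi, hRi⟩
      refine ⟨i, hi, ?_⟩
      by_contra! hne
      have hne' (j : Fin (n + 1)) (hj : j ≠ i) : R.rep j ≠ 0 := hne j hj hRi
      have : Nontrivial (Fin (n + 1)) := Fin.nontrivial_iff_two_le.2 (by omega)
      obtain ⟨j, hj⟩ := exists_ne i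
      have := (mem_eigLocus_iff _ _).1 hR i j
      rw [hRi, zero_mul, eval_pderiv_monomialForm, hi, h1, hRi] at this
      refine mul_ne_zero (hne' j hj) ?_ this
      simpa [Finset.prod_eq_zero_iff] using fun k hk h0 => absurd h0 (hne' k hk)
    · rintro ⟨i, hi, j, hji, hRi, hRj⟩
      refine ⟨mem_eigLocus_of_pderiv_eq_zero fun k => ?_, i, hi, hRi⟩
      obtain ⟨l, hlk, hRl⟩ : ∃ l, l ≠ k ∧ R.rep l = 0 := by
        rcases eq_or_ne i k with rfl | hik
        · exact ⟨j, hji, hRj⟩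
        · exact ⟨i, hik, hRi⟩
      have hl := hmin l
      rw [eval_pderiv_monomialForm,
        Finset.prod_eq_zero (Finset.mem_erase.2 ⟨hlk, Finset.mem_univ l⟩), mul_zero, mul_zero]
      rw [hRl, zero_pow (by omega)]
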